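/- All graphs are finite, simple and undirected. For a connected graph $G$, an edge-coloring (adjacent edges may receive the same color) makes $G$ conflict-free connected if every two distinct vertices are joined by a path containing a color that is used on exactly one of its edges; the conflict-free connection number $\mathrm{cfc}(G)$ is the smallest number of colors in such a coloring. Let $\overline{G}$ be the complement of $G$, let $\Delta(G)$ be its maximum degree, and let $\lambda(G)$ be its edge-connectivity, the minimum size of a set of edges whose removal leaves a disconnected graph (so $\lambda(G)=0$ if $G$ is disconnected). A cut-edge of a connected graph is an edge whose removal disconnects it. Theorem. Let $G$ be a connected graph of order $n\ge 4$ with $\lambda(G)=\lambda(\overline{G})=1$. Then $$4\le \mathrm{cfc}(G)+\mathrm{cfc}(\overline{G})\le n \quad\text{and}\quad 4\le \mathrm{cfc}(G)\cdot \mathrm{cfc}(\overline{G})\le 2(n-2).$$ Moreover: (i) Each of the equalities $\mathrm{cfc}(G)+\mathrm{cfc}(\overline{G})=n$ and $\mathrm{cfc}(G)\cdot\mathrm{cfc}(\overline{G})=2(n-2)$ holds if and only if at least one of $G$ and $\overline{G}$ is a tree with maximum degree $n-2$. (ii) Each of the equalities $\mathrm{cfc}(G)+\mathrm{cfc}(\overline{G})=4$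 and $\mathrm{cfc}(G)\cdot\mathrm{cfc}(\overline{G})=4$ holds if and only if both graphs $H\in\{G,\overline{G}\}$ have the property that every vertex of degree $\Delta(H)$ in $H$ is incident with at most two cut-edges of $H$. -/

import Mathlib

namespace SimpleGraph

variable {V : Type*}

/-- An edge-colored graph is conflict-free connected if every two distinct vertices are joined by
a path on which some color appears on exactly one edge. Adjacent edges may share a color. -/
def IsConflictFreeConnected {G : SimpleGraph V} {K : Type*} (C : G.EdgeLabeling K) : Prop :=
  ∀ u v : V, u ≠ v →
    ∃ p : G.Walk u v, p.IsPath ∧ ∃ i : K, ∃! e : G.edgeSet, (e : Sym2 V) ∈ p.edges ∧ C e = i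

/-- The conflict-free connection number of a (finite connected) graph: the least number of colors
with which the edges can be colored so that the graph is conflict-free connected. -/
noncomputable def cfc (G : SimpleGraph V) : ℕ :=
  sInf {k : ℕ | ∃ C : G.EdgeLabeling (Fin k), IsConflictFreeConnected C}

/-- The edge-connectivity of a (finite, nontrivial) graph: the least size of a set of edges
whose removal leaves a disconnected graph. It is `0` when the graph itself is disconnected. -/
noncomputable def edgeConn (G : SimpleGraph V) : ℕ :=
  sInf {k : ℕ | ∃ S : Finset (Sym2 V), (S : Set (Sym2 V)) ⊆ G.edgeSet ∧ S.card = k ∧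
    ¬ (G.deleteEdges (S : Set (Sym2 V))).Connected}

/-- The set of cut-edges of `G` incident with the vertex `v`. -/
def cutEdgesAt (G : SimpleGraph V) (v : V) : Set (Sym2 V) :=
  {e | e ∈ G.incidenceSet v ∧ G.IsBridge e}

/-- At most two cut-edges are incident with each vertex of maximum degree. -/
def AtMostTwoCutEdgesAtMaxDegree [Fintype V] (G : SimpleGraph V) [DecidableRel G.Adj] : Prop :=
  ∀ v : V, G.degree v = G.maxDegree → (G.cutEdgesAt v).ncard ≤ 2

end SimpleGraph

/-! Bridges in both `G` and its complement force each graph to contain a vertex `c` with exactly one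
non-neighbor `z` (`exists_isUniqueNonNeighbor_of_bridges`). For a connected graph with such a `c`,
the conflict-free connection number is the larger of 2 and the number `r` of bridges at `c`
(`IsUniqueNonNeighbor.cfc_eq`). Here `r ≤ n - 2`, with equality exactly for trees. If `r ≥ 3`, the
complement has number 2 (`IsUniqueNonNeighbor.cfc_compl_eq_two`). So one of the two numbers is
always 2 and the other lies between 2 and `n - 2`; the rest is arithmetic. -/

namespace SimpleGraph

/-! ### Bridges, cuts and short cycles -/

section Bridges

variable {V : Type*} {G : SimpleGraph V}

lemma Reachable.mem_of_closed {S : Set V} (hS : ∀ ⦃a b⦄, a ∈ S → G.Adj a b → b ∈ S) {u v : V}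
    (h : G.Reachable u v) (hu : u ∈ S) : v ∈ S := by
  obtain ⟨p⟩ := h
  induction p with
  | nil => exact hu
  | cons hadj _ ih => exact ih (hS hu hadj)

lemma deleteEdges_singleton_adj_of_ne {e : Sym2 V} {a b : V} (h : G.Adj a b) (hne : s(a, b) ≠ e) :
    (G.deleteEdges {e}).Adj a b := by
  simp [deleteEdges_adj, h, hne]

lemma not_isBridge_of_triangle {a b w : V} (h1 : G.Adj a w) (h2 : G.Adj w b) (hab : a ≠ b) :
    ¬ G.IsBridge s(a, b) := by
  rw [isBridge_iff, not_not]
  have e1 : s(a, w) ≠ s(a, b) := by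
    have := h2.ne; simp; grind
  have e2 : s(w, b) ≠ s(a, b) := by
    have := h1.ne; simp; grind
  exact (deleteEdges_singleton_adj_of_ne h1 e1).reachable.trans
    (deleteEdges_singleton_adj_of_ne h2 e2).reachable

lemma not_isBridge_of_square {a b w w' : V} (h1 : G.Adj a w) (h2 : G.Adj w w') (h3 : G.Adj w' b)
    (hw : w ≠ b) (hw' : w' ≠ a) : ¬ G.IsBridge s(a, b) := by
  rw [isBridge_iff, not_not]
  have e1 : s(a, w) ≠ s(a, b) := by
    simp; grind
  have e2 : s(w, w') ≠ s(a, b) := by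
    have := h1.ne; simp; grind
  have e3 : s(w', b) ≠ s(a, b) := by
    have := h1.ne; simp; grind
  exact ((deleteEdges_singleton_adj_of_ne h1 e1).reachable.trans
    (deleteEdges_singleton_adj_of_ne h2 e2).reachable).trans
    (deleteEdges_singleton_adj_of_ne h3 e3).reachable

lemma isBridge_of_closed {S : Set V} {a b : V} (ha : a ∈ S) (hb : b ∉ S)
    (hS : ∀ ⦃u v⦄, u ∈ S → v ∉ S → G.Adj u v → u = a ∧ v = b) : G.IsBridge s(a, b) := by
  rw [isBridge_iff]
  intro h
  refine hb (h.mem_of_closed (S := S) ?_ ha)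
  intro u v hu huv
  by_contra hv
  rw [deleteEdges_adj] at huv
  obtain ⟨rfl, rfl⟩ := hS hu hv huv.1
  simp at huv

lemma IsBridge.exists_cut {a b : V} (h : G.IsBridge s(a, b)) :
    ∃ S : Set V, a ∈ S ∧ b ∉ S ∧ ∀ ⦃u v⦄, u ∈ S → v ∉ S → G.Adj u v → u = a ∧ v = b := by
  rw [isBridge_iff] at h
  refine ⟨{v | (G.deleteEdges {s(a, b)}).Reachable a v}, Reachable.refl _, h, ?_⟩
  intro u v hu hv huv
  by_contra hne
  by_cases he : s(u, v) = s(a, b)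
  · rcases Sym2.eq_iff.1 he with h' | ⟨rfl, rfl⟩
    · exact hne h'
    · exact h hu
  · exact hv (Reachable.trans hu (deleteEdges_singleton_adj_of_ne huv he).reachable)

/-- A graph of edge-connectivity one is connected and has a bridge. -/
lemma connected_and_exists_isBridge_of_edgeConn_eq_one (h : G.edgeConn = 1) :
    G.Connected ∧ ∃ a b, G.Adj a b ∧ G.IsBridge s(a, b) := by
  have hc : G.Connected := by
    by_contra hc
    have : G.edgeConn ≤ 0 := Nat.sInf_le ⟨∅, by simp, by simp, by simpa using hc⟩
    omega
  refine ⟨hc, ?_⟩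
  have hne : {k : ℕ | ∃ S : Finset (Sym2 V), (S : Set (Sym2 V)) ⊆ G.edgeSet ∧ S.card = k ∧
    ¬ (G.deleteEdges (S : Set (Sym2 V))).Connected}.Nonempty := by
    -- The infimum of the empty set is 0, so the value 1 must be attained.
    by_contra h'
    rw [Set.not_nonempty_iff_eq_empty] at h'
    rw [edgeConn, h'] at h
    simp at h
  obtain ⟨S, hS, hcard, hdis⟩ := Nat.sInf_mem hne
  rw [show sInf _ = 1 from h, Finset.card_eq_one] at hcard
  obtain ⟨e, rfl⟩ := hcard
  induction e with | h a b =>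
  refine ⟨a, b, by simpa using hS, ?_⟩
  by_contra hb
  exact hdis (by simpa using hc.connected_delete_edge_of_not_isBridge hb)

end Bridges

/-! ### Vertices with a unique non-neighbor -/

section Dominating

variable {V : Type*} {G : SimpleGraph V} {c z : V}

/-- The vertex `z` is the only vertex other than `c` that is not adjacent to `c`. -/
def IsUniqueNonNeighbor (G : SimpleGraph V) (c z : V) : Prop :=
  z ≠ c ∧ ∀ w, G.Adj c w ↔ w ≠ c ∧ w ≠ z

lemma isUniqueNonNeighbor_iff_compl :
    G.IsUniqueNonNeighbor c z ↔ ∀ w, Gᶜ.Adj c w ↔ w = z := by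
  simp only [IsUniqueNonNeighbor, compl_adj]
  constructor
  · rintro ⟨h1, h2⟩ w; grind
  · intro h; have := (h z).2 rfl; grind [SimpleGraph.irrefl]

lemma isUniqueNonNeighbor_compl_iff :
    Gᶜ.IsUniqueNonNeighbor c z ↔ ∀ w, G.Adj c w ↔ w = z := by
  rw [isUniqueNonNeighbor_iff_compl, compl_compl]

lemma Connected.exists_adj_of_ne (hG : G.Connected) {a b : V} (hab : a ≠ b) : ∃ w, G.Adj a w := by
  obtain ⟨p⟩ := hG.preconnected a b
  cases p with
  | nil => exact absurd rfl hab
  | cons h _ => exact ⟨_, h⟩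

variable (h : G.IsUniqueNonNeighbor c z)
include h

lemma IsUniqueNonNeighbor.not_adj : ¬ G.Adj c z := fun h' => ((h.2 z).1 h').2 rfl

lemma IsUniqueNonNeighbor.adj_of_adj {w : V} (hw : G.Adj z w) : G.Adj c w :=
  (h.2 w).2 ⟨by rintro rfl; exact h.not_adj hw.symm, hw.ne'⟩

/-- A cycle through `cw` can be shortened to a triangle, or to a square through `z`, because `c`
sees everything but `z`. -/
lemma IsUniqueNonNeighbor.not_isBridge_iff {w : V} (hw : G.Adj c w) :
    ¬ G.IsBridge s(c, w) ↔
      (∃ w', G.Adj c w' ∧ G.Adj w w') ∨ (G.Adj z w ∧ ∃ w', w' ≠ w ∧ G.Adj z w') := by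
  constructor
  · intro hb
    by_contra hcon
    push Not at hcon
    -- If neither cycle exists, `w`, together with `z` when adjacent to it, is cut off from `c` by
    -- deleting `cw`.
    refine hb (Sym2.eq_swap ▸ isBridge_of_closed (S := {u | u = w ∨ u = z ∧ G.Adj z w})
      (Or.inl rfl) ?_ ?_)
    · rintro (h1 | h1)
      · exact hw.ne h1
      · exact h.1 h1.1.symm
    · rintro u v hu hv huv
      have := h.2 v
      have := h.not_adj
      have := huv.symm
      simp only [Set.mem_ofPred_eq] at hu hv
      grind
  · rintro (⟨w', h1, h2⟩ | ⟨h1, w', h2, h3⟩)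
    · exact not_isBridge_of_triangle h1 h2.symm hw.ne
    · exact not_isBridge_of_square (h.adj_of_adj h3) h3.symm h1 h2 h.1

/-- A graph with a bridge and a vertex with a unique non-neighbor has a pendant vertex. -/
lemma IsUniqueNonNeighbor.exists_pendant {a b : V} (hab : G.Adj a b) (hb : G.IsBridge s(a, b)) :
    ∃ x y, ∀ w, G.Adj x w ↔ w = y := by
  have key : ∀ w, G.Adj c w → G.IsBridge s(c, w) → ∃ x y, ∀ w, G.Adj x w ↔ w = y := by
    intro w hw hbr
    have := mt (h.not_isBridge_iff hw).2 (not_not.2 hbr)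
    push Not at this
    by_cases hz : G.Adj z w
    · exact ⟨z, w, fun u => ⟨fun hu => by_contra fun hne => this.2 hz u hne hu, fun hu => hu ▸ hz⟩⟩
    · refine ⟨w, c, fun u => ⟨fun hu => ?_, fun hu => hu ▸ hw.symm⟩⟩
      by_contra hne
      by_cases huz : u = z
      · exact hz (huz ▸ hu.symm)
      · exact this.1 u ((h.2 u).2 ⟨hne, huz⟩) hu
  -- A second neighbor of `z` would put `zw` on a square through `c`.
  have key2 : ∀ w, G.Adj z w → G.IsBridge s(z, w) → ∃ x y, ∀ w, G.Adj x w ↔ w = y := by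
    intro w hw hbr
    refine ⟨z, w, fun u => ⟨fun hu => by_contra fun hne => ?_, fun hu => hu ▸ hw⟩⟩
    exact not_isBridge_of_square hu (h.adj_of_adj hu).symm (h.adj_of_adj hw) hne h.1.symm hbr
  by_cases h1 : a = c
  · subst h1; exact key b hab hb
  by_cases h2 : b = c
  · subst h2; exact key a hab.symm (Sym2.eq_swap ▸ hb)
  by_cases h3 : a = z
  · subst h3; exact key2 b hab hb
  by_cases h4 : b = z
  · subst h4; exact key2 a hab.symm (Sym2.eq_swap ▸ hb)
  · exact absurd hb (not_isBridge_of_triangle ((h.2 a).2 ⟨h1, h3⟩).symm ((h.2 b).2 ⟨h2, h4⟩) hab.ne)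

end Dominating

/-! ### Pendant vertices from bridges on both sides -/

section Pendant

variable {V : Type*} {G : SimpleGraph V}

/-- Without pendant vertices, `x` has a neighbor besides `y`, and that one has a neighbor besides
`x`. Both lie in `S`, since `xy` is the only edge leaving it. -/
lemma exists_two_other {S : Set V} (hp : ¬ ∃ x y, ∀ w, G.Adj x w ↔ w = y)
    {x y : V} (hxy : G.Adj x y) (hx : x ∈ S) 
    (hS : ∀ ⦃u v⦄, u ∈ S → v ∉ S → G.Adj u v → u = x ∧ v = y) (u : V) :
    ∃ a ∈ S, a ≠ x ∧ a ≠ u := by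
  push Not at hp
  have other : ∀ v w, G.Adj v w → ∃ w', G.Adj v w' ∧ w' ≠ w := by
    intro v w hvw
    obtain ⟨w', h⟩ := hp v w
    rcases h with h | h
    · exact ⟨w', h⟩
    · exact absurd (h.2 ▸ hvw) h.1
  obtain ⟨a, ha, hay⟩ := other x y hxy
  have haS : a ∈ S := by by_contra h; exact hay (hS hx h ha).2
  obtain ⟨b, hb, hbx⟩ := other a x ha.symm
  have hbS : b ∈ S := by by_contra h; exact ha.ne' (hS haS h hb).1
  by_cases hau : a = u
  · exact ⟨b, hbS, hbx, fun h => hb.ne (hau.trans h.symm)⟩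
  · exact ⟨a, haS, ha.ne', hau⟩

/-- If a graph and its complement both have bridges, the graph has a pendant vertex. -/
lemma exists_pendant_of_compl_isBridge {x y : V} (hxy : G.Adj x y)
    (hb : G.IsBridge s(x, y)) {u v : V} (huv : Gᶜ.Adj u v) (hb' : Gᶜ.IsBridge s(u, v)) :
    ∃ x y, ∀ w, G.Adj x w ↔ w = y := by
  by_contra hp
  obtain ⟨S, hx, hy, hS⟩ := hb.exists_cut
  have hA := exists_two_other hp hxy hx hS
  have hB := exists_two_other (S := Sᶜ) hp hxy.symm hy
    (fun a b ha hb hab => (hS (not_not.1 hb) ha hab.symm).symm)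
  -- The complement contains all pairs across the cut except `xy`; with two spare vertices on each
  -- side, each of its edges lies on a triangle or square.
  have cross : ∀ a b, a ∈ S → b ∉ S → (a ≠ x ∨ b ≠ y) → Gᶜ.Adj a b := by
    intro a b ha hb hne
    rw [compl_adj]
    refine ⟨fun h => hb (h ▸ ha), fun h => ?_⟩
    obtain ⟨h1, h2⟩ := hS ha hb h
    tauto
  have mixed : ∀ u v, u ∈ S → v ∉ S → ¬ Gᶜ.IsBridge s(u, v) := by
    intro u v hu hv
    obtain ⟨a, haS, hax, hau⟩ := hA u
    obtain ⟨b, hbS, hby, hbv⟩ := hB v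
    exact not_isBridge_of_square (cross u b hu hbS (Or.inr hby))
      (cross a b haS hbS (Or.inl hax)).symm (cross a v haS hv (Or.inl hax)) hbv hau
  by_cases hu : u ∈ S <;> by_cases hv : v ∈ S
  · obtain ⟨b, hbS, hby, -⟩ := hB y
    exact not_isBridge_of_triangle (cross u b hu hbS (Or.inr hby))
      (cross v b hv hbS (Or.inr hby)).symm huv.ne hb'
  · exact mixed u v hu hv hb'
  · exact mixed v u hv hu (Sym2.eq_swap ▸ hb')
  · obtain ⟨a, haS, hax, -⟩ := hA x
    exact not_isBridge_of_triangle (cross a u haS hu (Or.inl hax)).symm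
      (cross a v haS hv (Or.inl hax)) huv.ne hb'

/-- If a graph and its complement both have bridges, then each of them has a
vertex with a unique non-neighbor. -/
lemma exists_isUniqueNonNeighbor_of_bridges {x y : V} (hxy : G.Adj x y) (hb : G.IsBridge s(x, y)) {u v : V} (huv : Gᶜ.Adj u v)
    (hb' : Gᶜ.IsBridge s(u, v)) :
    (∃ c z, G.IsUniqueNonNeighbor c z) ∧ ∃ c z, Gᶜ.IsUniqueNonNeighbor c z := by
  obtain ⟨p, q, hpq⟩ := exists_pendant_of_compl_isBridge hxy hb huv hb'
  have h1 := isUniqueNonNeighbor_compl_iff.2 hpq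
  -- A pendant vertex of one graph is a vertex with a unique non-neighbor in the other.
  obtain ⟨r, s, hrs⟩ := h1.exists_pendant huv hb'
  exact ⟨⟨r, s, isUniqueNonNeighbor_iff_compl.2 hrs⟩, p, q, h1⟩

end Pendant

end SimpleGraph
namespace SimpleGraph

/-! ### Lower bounds on the number of colors -/

section LowerBound

variable {V : Type*} {G : SimpleGraph V}

/-- Two bridges at a common vertex have distinct colors. -/
lemma IsConflictFreeConnected.ne_of_isBridge {K : Type*} {C : G.EdgeLabeling K}
    (hC : IsConflictFreeConnected C) {c w w' : V} (hw : G.Adj c w) (hw' : G.Adj c w')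
    (hb : G.IsBridge s(c, w)) (hb' : G.IsBridge s(c, w')) (hne : w ≠ w') :
    C ⟨s(c, w), hw⟩ ≠ C ⟨s(c, w'), hw'⟩ := by
  intro hcol
  obtain ⟨p, hp, i, ⟨e, he⟩, ⟨hep, hei⟩, huniq⟩ := hC w w' hne
  have m1 : s(c, w) ∈ p.edges := by
    have := isBridge_iff_forall_walk_mem_edges.1 hb (Walk.cons hw' p.reverse)
    simp only [Walk.edges_cons, Walk.edges_reverse, List.mem_cons, List.mem_reverse] at this
    rcases this with h | h
    · simp at h; grind
    · exact h
  have m2 : s(c, w') ∈ p.edges := by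
    have := isBridge_iff_forall_walk_mem_edges.1 hb' (Walk.cons hw p)
    simp only [Walk.edges_cons, List.mem_cons] at this
    rcases this with h | h
    · simp at h; grind
    · exact h
  have key : e = s(c, w) ∨ e = s(c, w') := by
    -- A path from `w` to `w'` using both bridges can only be `w, c, w'`.
    match p, hp with
    | .nil, _ => exact absurd rfl hne
    | .cons (v := a) h q, hp =>
      rw [Walk.cons_isPath_iff] at hp
      obtain rfl : c = a := by
        rw [Walk.edges_cons, List.mem_cons] at m1
        rcases m1 with h1 | h1
        · have := hw.ne; simp at h1; grind
        · exact absurd (Walk.snd_mem_support_of_mem_edges _ h1) hp.2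
      match q, hp with
      | .nil, _ => exact absurd rfl hw'.ne
      | .cons (v := b) h' r, hp =>
        rw [Walk.cons_isPath_iff] at hp
        obtain rfl : w' = b := by
          simp only [Walk.edges_cons, List.mem_cons] at m2
          rcases m2 with h1 | h1 | h1
          · have := hw.ne; simp at h1; grind
          · exact Sym2.congr_right.1 h1
          · exact absurd (Walk.fst_mem_support_of_mem_edges _ h1) hp.1.2
        have : r = .nil := by simpa using hp.1.1
        subst this
        simp at hep
        rcases hep with rfl | rfl
        · exact Or.inl Sym2.eq_swap
        · exact Or.inr rfl
  have u1 : i = C ⟨s(c, w), hw⟩ := by rcases key with rfl | rfl <;> grind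
  have h1 := huniq ⟨s(c, w), hw⟩ ⟨m1, u1.symm⟩
  have h2 := huniq ⟨s(c, w'), hw'⟩ ⟨m2, by rw [u1, hcol]⟩
  exact hne (Sym2.congr_right.1 (congrArg Subtype.val (h1.trans h2.symm)))

/-- With one color, a path having a uniquely colored edge has length one. -/
lemma IsConflictFreeConnected.adj_of_subsingleton {K : Type*} [Subsingleton K]
    {C : G.EdgeLabeling K} (hC : IsConflictFreeConnected C) {u v : V} (huv : u ≠ v) :
    G.Adj u v := by
  obtain ⟨p, hp, i, e, -, huniq⟩ := hC u v huv
  have hall : ∀ e' (h : e' ∈ p.edges), e' = e :=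
    fun e' h => congrArg Subtype.val
      (huniq ⟨e', p.edges_subset_edgeSet h⟩ ⟨h, Subsingleton.elim _ _⟩)
  match p, hp with
  | .nil, _ => exact absurd rfl huv
  | .cons h .nil, _ => exact h
  | .cons (v := a) h (.cons (v := b) h' r), hp =>
    have h1 := hall s(u, a) (by simp)
    have h2 := hall s(a, b) (by simp)
    have h3 := h1.trans h2.symm
    simp only [Walk.cons_isPath_iff, Walk.support_cons, List.mem_cons] at hp
    have := r.start_mem_support
    simp at h3
    grind

lemma ncard_cutEdgesAt (c : V) :
    (G.cutEdgesAt c).ncard = {w | G.Adj c w ∧ G.IsBridge s(c, w)}.ncard := by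
  rw [← Set.ncard_image_of_injective (f := fun w => s(c, w)) _
    (fun a b h => Sym2.congr_right.1 h)]
  congr 1
  ext e
  simp only [cutEdgesAt, Set.mem_ofPred_eq, Set.mem_image, incidenceSet]
  constructor
  · rintro ⟨⟨h1, h2⟩, h3⟩
    obtain ⟨w, rfl⟩ := Sym2.mem_iff_exists.1 h2
    exact ⟨w, ⟨h1, h3⟩, rfl⟩
  · rintro ⟨w, ⟨h1, h2⟩, rfl⟩
    exact ⟨⟨h1, by simp⟩, h2⟩

lemma IsConflictFreeConnected.ncard_cutEdgesAt_le {k : ℕ} {C : G.EdgeLabeling (Fin k)}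
    (hC : IsConflictFreeConnected C) (c : V) : (G.cutEdgesAt c).ncard ≤ k := by
  have hinj : Function.Injective
      (fun e : G.cutEdgesAt c => C ⟨e.1, e.2.1.1⟩) := by
    rintro ⟨e, ⟨h1, h2⟩, h3⟩ ⟨e', ⟨h1', h2'⟩, h3'⟩ heq
    obtain ⟨w, rfl⟩ := Sym2.mem_iff_exists.1 h2
    obtain ⟨w', rfl⟩ := Sym2.mem_iff_exists.1 h2'
    by_contra hne
    exact hC.ne_of_isBridge h1 h1' h3 h3' (by rintro rfl; exact hne rfl) heq
  simpa using Nat.card_le_card_of_injective _ hinj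

end LowerBound

/-! ### An optimal coloring -/

section UpperBound

variable {V : Type*} {G : SimpleGraph V} {K : Type*}

/-- The vertices `u` and `v` are joined by a path on which exactly one edge has its color. -/
def ConflictFreeJoined (G : SimpleGraph V) (f : Sym2 V → K) (u v : V) : Prop :=
  ∃ p : G.Walk u v, p.IsPath ∧ ∃ e ∈ p.edges, ∀ e' ∈ p.edges, f e' = f e → e' = e

lemma isConflictFreeConnected_of_joined {f : Sym2 V → K}
    (h : ∀ u v, u ≠ v → G.ConflictFreeJoined f u v) :
    IsConflictFreeConnected (G := G) (fun e => f e : G.EdgeLabeling K) := by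
  intro u v huv
  obtain ⟨p, hp, e, he, hu⟩ := h u v huv
  exact ⟨p, hp, f e, ⟨e, p.edges_subset_edgeSet he⟩, ⟨he, rfl⟩,
    fun e' h' => Subtype.ext (hu _ h'.1 h'.2)⟩

variable {f : Sym2 V → K} {u v a b d : V}

lemma ConflictFreeJoined.symm (h : G.ConflictFreeJoined f u v) : G.ConflictFreeJoined f v u := by
  obtain ⟨p, hp, e, he, hu⟩ := h
  exact ⟨p.reverse, hp.reverse, e, by simpa using he, by simpa using hu⟩

lemma Adj.conflictFreeJoined (h : G.Adj u v) : G.ConflictFreeJoined f u v :=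
  ⟨.cons h .nil, by simpa using h.ne, s(u, v), by simp, by simp⟩

lemma conflictFreeJoined_of_two (h1 : G.Adj u a) (h2 : G.Adj a v) (huv : u ≠ v)
    (hf : f s(u, a) ≠ f s(a, v)) : G.ConflictFreeJoined f u v := by
  refine ⟨.cons h1 (.cons h2 .nil), by simp [h1.ne, h2.ne, huv], s(u, a), by simp, ?_⟩
  simp only [Walk.edges_cons, Walk.edges_nil, List.mem_cons, List.not_mem_nil, or_false]
  rintro e (rfl | rfl) h
  · rfl
  · exact absurd h.symm hf

lemma conflictFreeJoined_of_three (h1 : G.Adj u a) (h2 : G.Adj a b) (h3 : G.Adj b v)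
    (huv : u ≠ v) (hub : u ≠ b) (hav : a ≠ v)
    (hf : (f s(u, a) ≠ f s(a, b) ∧ f s(u, a) ≠ f s(b, v)) ∨
      (f s(a, b) ≠ f s(u, a) ∧ f s(a, b) ≠ f s(b, v))) : G.ConflictFreeJoined f u v := by
  refine ⟨.cons h1 (.cons h2 (.cons h3 .nil)), by simp [h1.ne, h2.ne, h3.ne, huv, hub, hav], ?_⟩
  simp only [Walk.edges_cons, Walk.edges_nil, List.mem_cons, List.not_mem_nil, or_false]
  rcases hf with hf | hf
  · refine ⟨s(u, a), by simp, ?_⟩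
    rintro e (rfl | rfl | rfl) h <;> grind
  · refine ⟨s(a, b), by simp, ?_⟩
    rintro e (rfl | rfl | rfl) h <;> grind

lemma conflictFreeJoined_of_four (h1 : G.Adj u a) (h2 : G.Adj a b) (h3 : G.Adj b d)
    (h4 : G.Adj d v) (huv : u ≠ v) (hub : u ≠ b) (hav : a ≠ v) (hud : u ≠ d) (had : a ≠ d)
    (hbv : b ≠ v)
    (hf : (f s(u, a) ≠ f s(a, b) ∧ f s(u, a) ≠ f s(b, d) ∧ f s(u, a) ≠ f s(d, v)) ∨
      (f s(a, b) ≠ f s(u, a) ∧ f s(a, b) ≠ f s(b, d) ∧ f s(a, b) ≠ f s(d, v))) :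
    G.ConflictFreeJoined f u v := by
  refine ⟨.cons h1 (.cons h2 (.cons h3 (.cons h4 .nil))),
    by simp [h1.ne, h2.ne, h3.ne, h4.ne, huv, hub, hav, hud, had, hbv], ?_⟩
  simp only [Walk.edges_cons, Walk.edges_nil, List.mem_cons, List.not_mem_nil, or_false]
  rcases hf with hf | hf
  · refine ⟨s(u, a), by simp, ?_⟩
    rintro e (rfl | rfl | rfl | rfl) h <;> grind
  · refine ⟨s(a, b), by simp, ?_⟩
    rintro e (rfl | rfl | rfl | rfl) h <;> grind

/-- A map that is injective on a given small set, vanishes off it, and vanishes at one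
given point. -/
lemma exists_injOn_fin {k : ℕ} [NeZero k] [Finite V] (B : Set V) (hB : B.ncard ≤ k) (w : V) :
    ∃ g : V → Fin k, Set.InjOn g B ∧ g w = 0 ∧ ∀ v, v ∉ B → g v = 0 := by
  classical
  obtain ⟨φ, hφ⟩ : ∃ φ : B → Fin k, Function.Injective φ := by
    have : Fintype B := Fintype.ofFinite _
    obtain ⟨φ⟩ := Function.Embedding.nonempty_of_card_le (α := B) (β := Fin k)
      (by rw [← Nat.card_eq_fintype_card, Nat.card_coe_set_eq]; simpa using hB)
    exact ⟨φ, φ.injective⟩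
  by_cases hw : w ∈ B
  · refine ⟨fun v => if h : v ∈ B then Equiv.swap (φ ⟨w, hw⟩) 0 (φ ⟨v, h⟩) else 0, ?_, ?_, ?_⟩
    · intro a ha b hb hab
      simp only [ha, hb, dif_pos] at hab
      simpa using hφ ((Equiv.injective _) hab)
    · simp [hw]
    · intro v hv; simp [hv]
  · refine ⟨fun v => if h : v ∈ B then φ ⟨v, h⟩ else 0, ?_, ?_, ?_⟩
    · intro a ha b hb hab
      simp only [ha, hb, dif_pos] at hab
      simpa using hφ hab
    · simp [hw]
    · intro v hv; simp [hv]

/-- An edge coloring with prescribed values at the pairs containing `c`. -/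
lemma exists_extension (c : V) (g : V → K) (h : Sym2 V → K) :
    ∃ f : Sym2 V → K, (∀ w, f s(c, w) = g w) ∧ ∀ e, c ∉ e → f e = h e := by
  classical
  refine ⟨fun e => if hc : c ∈ e then g (Sym2.Mem.other hc) else h e, fun w => ?_, fun e he => ?_⟩
  · have hc : c ∈ s(c, w) := by simp
    have : Sym2.Mem.other hc = w :=
      Sym2.congr_right.1 (Sym2.other_spec hc)
    simp only [hc, dif_pos, this]
  · simp [he]

/-- Bridges at `c` get distinct colors, other edges at `c` get 0, and edges avoiding `c` get 1,
except that `zw₀` gets 0 when `z` has a second neighbor. Two neighbors of `c` whose edges to `c`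
share a color cannot both be on bridges there, so a triangle or square offers a detour. -/
lemma IsUniqueNonNeighbor.exists_coloring [Finite V] {c z : V} (hG : G.Connected)
    (h : G.IsUniqueNonNeighbor c z) {k : ℕ} (hk : 2 ≤ k) (hB : (G.cutEdgesAt c).ncard ≤ k) :
    ∃ C : G.EdgeLabeling (Fin k), IsConflictFreeConnected C := by
  classical
  obtain ⟨k, rfl⟩ : ∃ m, k = m + 2 := ⟨k - 2, by omega⟩
  rw [ncard_cutEdgesAt] at hB
  obtain ⟨w₀, hw₀⟩ := hG.exists_adj_of_ne h.1
  obtain ⟨g, hinj, hg₀, hgB⟩ := exists_injOn_fin _ hB w₀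
  have h01 : (0 : Fin (k + 2)) ≠ 1 := by simp
  have h10 := h01.symm
  obtain ⟨f, hfc, hf⟩ := exists_extension c g
    (fun e => if e = s(z, w₀) ∧ ∃ w, w ≠ w₀ ∧ G.Adj z w then (0 : Fin (k + 2)) else 1)
  have hfc' : ∀ w, f s(w, c) = g w := fun w => Sym2.eq_swap ▸ hfc w
  have hfb : ∀ a b, G.Adj c a → G.Adj c b → f s(a, b) = 1 := by
    intro a b ha hb
    have := ha.ne; have := hb.ne
    have h1 := (h.2 a).1 ha
    have h2 := (h.2 b).1 hb
    rw [hf _ (by simp; grind), if_neg]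
    rintro ⟨h', -⟩
    simp at h'; grind
  have hfz : ∀ w, G.Adj z w → w ≠ w₀ → f s(z, w) = 1 ∧ f s(z, w₀) = 0 := by
    intro w hw hne
    have h1 := (h.adj_of_adj hw).ne
    have h2 := (h.adj_of_adj hw₀).ne
    have h3 := h.1
    constructor
    · rw [hf _ (by simp; grind), if_neg]
      rintro ⟨h', -⟩
      simp at h'; grind
    · rw [hf _ (by simp; grind), if_pos ⟨rfl, w, hne, hw⟩]
  have hfz' : ∀ w, G.Adj z w → w ≠ w₀ → f s(w, z) = 1 ∧ f s(w₀, z) = 0 := by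
    intro w hw hne
    rw [Sym2.eq_swap, Sym2.eq_swap (a := w₀)]
    exact hfz w hw hne
  have hgz : ∀ w, G.Adj z w → g w = 0 := by
    intro w hw
    by_cases hne : w = w₀
    · exact hne ▸ hg₀
    · refine hgB w fun hb => ?_
      exact (h.not_isBridge_iff (h.adj_of_adj hw)).2 (Or.inr ⟨hw, w₀, Ne.symm hne, hw₀⟩) hb.2
  obtain ⟨w₁, hw₁, hfw₁⟩ : ∃ w, G.Adj z w ∧ f s(z, w) = 1 := by
    by_cases hex : ∃ w, w ≠ w₀ ∧ G.Adj z w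
    · obtain ⟨w, hw, hzw⟩ := hex
      exact ⟨w, hzw, (hfz w hzw hw).1⟩
    · refine ⟨w₀, hw₀, ?_⟩
      have h2 := (h.adj_of_adj hw₀).ne
      have h3 := h.1
      rw [hf _ (by simp; grind), if_neg (fun h' => hex h'.2)]
  have hfw₁' : f s(w₁, z) = 1 := Sym2.eq_swap ▸ hfw₁
  have hcw₁ := h.adj_of_adj hw₁
  have joined_cz : G.ConflictFreeJoined f c z :=
    conflictFreeJoined_of_two hcw₁ hw₁.symm h.1.symm (by rw [hfc, hgz _ hw₁, hfw₁']; exact h01)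
  have joined_zw : ∀ w, G.Adj c w → G.ConflictFreeJoined f z w := by
    intro w hw
    by_cases hzw : G.Adj z w
    · exact hzw.conflictFreeJoined
    refine conflictFreeJoined_of_three hw₁ hcw₁.symm hw (fun h' => h.not_adj (h' ▸ hw)) h.1
      (fun h' => hzw (h' ▸ hw₁)) ?_
    rw [hfw₁, hfc', hfc, hgz _ hw₁]
    -- The path `z, w₁, c, w` has colors 1, 0, `g w`.
    by_cases hgw : g w = 1
    · right; rw [hgw]; exact ⟨h01, h01⟩
    · left; exact ⟨h10, Ne.symm hgw⟩
  have joined_of_notMem : ∀ w w', G.Adj c w → G.Adj c w' → w ≠ w' → g w = g w' →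
      ¬ G.IsBridge s(c, w) → G.ConflictFreeJoined f w w' := by
    intro w w' hw hw' hne heq hb
    have hgw : g w = 0 := hgB w fun h => hb h.2
    rw [hgw] at heq
    rcases (h.not_isBridge_iff hw).1 hb with ⟨x, hcx, hwx⟩ | ⟨hzw, x, hxw, hzx⟩
    · by_cases hx : x = w'
      · exact (hx ▸ hwx).conflictFreeJoined
      have hgx : g x = 0 := hgB x fun hb' =>
        (h.not_isBridge_iff hcx).2 (Or.inl ⟨w, hw, hwx.symm⟩) hb'.2
      refine conflictFreeJoined_of_three hwx hcx.symm hw' hne hw.ne' hx (Or.inl ?_)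
      rw [hfb _ _ hw hcx, hfc', hfc, hgx, ← heq]
      exact ⟨h10, h10⟩
    have hw'z : z ≠ w' := fun h' => h.not_adj (h' ▸ hw')
    have hcx := h.adj_of_adj hzx
    -- The detour goes through `z` and uses `zw₀`, so exactly one edge on it has color 1.
    by_cases hww₀ : w = w₀
    · obtain ⟨f1, f2⟩ := hfz x hzx (hww₀ ▸ hxw)
      by_cases hx : x = w'
      · subst hx
        refine conflictFreeJoined_of_two hzw.symm hzx hne ?_
        rw [f1, hww₀, Sym2.eq_swap, f2]; exact h01
      · refine conflictFreeJoined_of_four hzw.symm hzx hcx.symm hw' hne hxw.symm hw'z hw.ne' h.1 hx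
          (Or.inr ?_)
        rw [f1, hww₀, Sym2.eq_swap, f2, hfc', hfc, hgz x hzx, ← heq]
        exact ⟨h10, h10, h10⟩
    · obtain ⟨f1, f2⟩ := hfz w hzw hww₀
      by_cases hx : w₀ = w'
      · subst hx
        refine conflictFreeJoined_of_two hzw.symm hw₀ hne ?_
        rw [f2, Sym2.eq_swap, f1]; exact h10
      · refine conflictFreeJoined_of_four hzw.symm hw₀ (h.adj_of_adj hw₀).symm hw' hne hww₀ hw'z
          hw.ne' h.1 hx (Or.inl ?_)
        rw [f2, Sym2.eq_swap, f1, hfc', hfc, hg₀, ← heq]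
        exact ⟨h10, h10, h10⟩
  have joined_ww : ∀ w w', G.Adj c w → G.Adj c w' → w ≠ w' → G.ConflictFreeJoined f w w' := by
    intro w w' hw hw' hne
    by_cases heq : g w = g w'
    · by_cases hb : G.IsBridge s(c, w)
      · by_cases hb' : G.IsBridge s(c, w')
        · exact absurd (hinj ⟨hw, hb⟩ ⟨hw', hb'⟩ heq) hne
        · exact (joined_of_notMem w' w hw' hw hne.symm heq.symm hb').symm
      · exact joined_of_notMem w w' hw hw' hne heq hb
    · exact conflictFreeJoined_of_two hw.symm hw' hne (by rwa [hfc', hfc])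
  refine ⟨_, isConflictFreeConnected_of_joined (f := f) fun u v huv => ?_⟩
  have tri : ∀ x, x = c ∨ x = z ∨ G.Adj c x := by
    intro x; rw [h.2]; tauto
  rcases tri u with rfl | rfl | hu <;> rcases tri v with rfl | rfl | hv
  · exact absurd rfl huv
  · exact joined_cz
  · exact hv.conflictFreeJoined
  · exact joined_cz.symm
  · exact absurd rfl huv
  · exact joined_zw v hv
  · exact hu.symm.conflictFreeJoined
  · exact (joined_zw u hu).symm
  · exact joined_ww u v hu hv huv

/-- The conflict-free connection number of a connected graph with a vertex `c` adjacent to all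
other vertices but one is the number of bridges at `c`, or two if that is larger. -/
theorem IsUniqueNonNeighbor.cfc_eq [Finite V] {c z : V} (hG : G.Connected)
    (h : G.IsUniqueNonNeighbor c z) : G.cfc = max 2 (G.cutEdgesAt c).ncard := by
  refine le_antisymm (Nat.sInf_le (h.exists_coloring hG (le_max_left _ _) (le_max_right _ _))) ?_
  refine le_csInf ⟨_, h.exists_coloring hG (le_max_left _ _) (le_max_right _ _)⟩ ?_
  rintro k ⟨C, hC⟩
  refine max_le ?_ (hC.ncard_cutEdgesAt_le c)
  by_contra hk
  have : Subsingleton (Fin k) := by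
    rw [Fin.subsingleton_iff_le_one]; omega
  exact h.not_adj (hC.adj_of_subsingleton h.1.symm)

end UpperBound

end SimpleGraph
namespace SimpleGraph

/-! ### Degrees, trees and the complement -/

section Nordhaus

variable {V : Type*} [Fintype V] {G : SimpleGraph V} {c z : V}

lemma IsUniqueNonNeighbor.degree_eq [DecidableRel G.Adj] (h : G.IsUniqueNonNeighbor c z) :
    G.degree c = Fintype.card V - 2 := by
  classical
  have : G.neighborFinset c = {c, z}ᶜ := by
    ext w; simp [h.2]
  rw [← card_neighborFinset_eq_degree, this, Finset.card_compl, Finset.card_pair h.1.symm]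

lemma Connected.degree_le_of_compl [DecidableRel G.Adj] (hc : Gᶜ.Connected) [Nontrivial V]
    (v : V) : G.degree v ≤ Fintype.card V - 2 := by
  classical
  obtain ⟨u, hu⟩ := exists_ne v
  obtain ⟨w, hw⟩ := hc.exists_adj_of_ne hu.symm
  have h1 := G.degree_compl (v := v)
  have h2 : 0 < Gᶜ.degree v := (Gᶜ.degree_pos_iff_exists_adj v).2 ⟨w, hw⟩
  omega

lemma IsUniqueNonNeighbor.maxDegree_eq [DecidableRel G.Adj] (h : G.IsUniqueNonNeighbor c z)
    (hc : Gᶜ.Connected) : G.maxDegree = Fintype.card V - 2 := by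
  have : Nontrivial V := ⟨z, c, h.1⟩
  exact le_antisymm (G.maxDegree_le_of_forall_degree_le _ hc.degree_le_of_compl)
    (h.degree_eq ▸ G.degree_le_maxDegree c)

lemma exists_isUniqueNonNeighbor_of_degree_eq [DecidableRel G.Adj] {v : V}
    (hV : 2 ≤ Fintype.card V) (hv : G.degree v = Fintype.card V - 2) :
    ∃ z, G.IsUniqueNonNeighbor v z := by
  classical
  have h1 : Gᶜ.degree v = 1 := by rw [degree_compl]; omega
  obtain ⟨z, hz, hu⟩ := (Gᶜ.degree_eq_one_iff_existsUnique_adj).1 h1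
  exact ⟨z, isUniqueNonNeighbor_iff_compl.2 fun w => ⟨hu w, fun h => h ▸ hz⟩⟩

/-- The maximum degree is `n - 2`, so every vertex attaining it has a unique non-neighbor and
`cfc_eq` applies at each. -/
lemma IsUniqueNonNeighbor.atMostTwo_iff [DecidableRel G.Adj] (h : G.IsUniqueNonNeighbor c z)
    (hG : G.Connected) (hc : Gᶜ.Connected) :
    G.AtMostTwoCutEdgesAtMaxDegree ↔ G.cfc = 2 := by
  have hV : 2 ≤ Fintype.card V := Fintype.one_lt_card_iff_nontrivial.2 ⟨z, c, h.1⟩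
  have hmax := h.maxDegree_eq hc
  constructor
  · intro hall
    have := hall c (by rw [hmax, h.degree_eq])
    rw [h.cfc_eq hG]; omega
  · intro hcfc v hv
    obtain ⟨z', hz'⟩ := exists_isUniqueNonNeighbor_of_degree_eq hV (hv.trans hmax)
    rw [hz'.cfc_eq hG] at hcfc
    omega

omit [Fintype V] in
lemma IsUniqueNonNeighbor.bridges_subset (h : G.IsUniqueNonNeighbor c z) :
    {w | G.Adj c w ∧ G.IsBridge s(c, w)} ⊆ ({c, z}ᶜ : Set V) := by
  rintro w ⟨hw, -⟩
  have := (h.2 w).1 hw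
  simpa using this

lemma IsUniqueNonNeighbor.ncard_compl_pair (h : G.IsUniqueNonNeighbor c z) :
    ({c, z}ᶜ : Set V).ncard = Fintype.card V - 2 := by
  rw [Set.ncard_compl, Set.ncard_pair h.1.symm, Nat.card_eq_fintype_card]

lemma IsUniqueNonNeighbor.ncard_cutEdgesAt_le (h : G.IsUniqueNonNeighbor c z) :
    (G.cutEdgesAt c).ncard ≤ Fintype.card V - 2 := by
  rw [ncard_cutEdgesAt, ← h.ncard_compl_pair]
  exact Set.ncard_le_ncard h.bridges_subset

/-- If all edges at `c` are bridges, there is no triangle at `c` and no square through `c` and `z`;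
so `z` is pendant and every edge is a bridge. -/
lemma IsUniqueNonNeighbor.ncard_cutEdgesAt_eq_iff (h : G.IsUniqueNonNeighbor c z)
    (hG : G.Connected) : (G.cutEdgesAt c).ncard = Fintype.card V - 2 ↔ G.IsTree := by
  rw [ncard_cutEdgesAt, ← h.ncard_compl_pair]
  constructor
  · intro heq
    have hset := Set.eq_of_subset_of_ncard_le h.bridges_subset heq.ge
    have hb : ∀ w, G.Adj c w → G.IsBridge s(c, w) := by
      intro w hw
      have : w ∈ ({c, z}ᶜ : Set V) := by simpa using (h.2 w).1 hw
      exact (hset ▸ this : w ∈ {w | G.Adj c w ∧ G.IsBridge s(c, w)}).2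
    have hz : ∀ w, G.Adj z w → G.IsBridge s(z, w) := by
      intro w hw
      refine isBridge_of_closed (S := {z}) rfl (fun h' => hw.ne h'.symm) ?_
      rintro u v rfl - huv
      refine ⟨rfl, by_contra fun hne => ?_⟩
      exact (h.not_isBridge_iff (h.adj_of_adj hw)).2 (Or.inr ⟨hw, v, hne, huv⟩)
        (hb w (h.adj_of_adj hw))
    refine ⟨hG, isAcyclic_iff_forall_adj_isBridge.2 fun v w hvw => ?_⟩
    by_cases h1 : v = c
    · subst h1; exact hb w hvw
    by_cases h2 : w = c
    · subst h2; exact Sym2.eq_swap ▸ hb v hvw.symm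
    by_cases h3 : v = z
    · subst h3; exact hz w hvw
    by_cases h4 : w = z
    · subst h4; exact Sym2.eq_swap ▸ hz v hvw.symm
    have hv := (h.2 v).2 ⟨h1, h3⟩
    exact absurd (hb v hv) ((h.not_isBridge_iff hv).2 (Or.inl ⟨w, (h.2 w).2 ⟨h2, h4⟩, hvw⟩))
  · intro ht
    congr 1
    refine h.bridges_subset.antisymm fun w hw => ?_
    have hw : G.Adj c w := (h.2 w).2 (by simpa using hw)
    exact ⟨hw, isAcyclic_iff_forall_adj_isBridge.1 ht.isAcyclic hw⟩

/-- If some dominating vertex of `G` is on at least three bridges, the complement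
has conflict-free connection number two. -/
lemma IsUniqueNonNeighbor.cfc_compl_eq_two (h : G.IsUniqueNonNeighbor c z) (hc : Gᶜ.Connected)
    (h3 : 3 ≤ (G.cutEdgesAt c).ncard) : Gᶜ.cfc = 2 := by
  -- At most one of three bridges at `c` ends at a neighbor of `z`; the other two end at pendant
  -- vertices.
  obtain ⟨p, q, hpq, hp, hq⟩ : ∃ p q, p ≠ q ∧ (∀ w, G.Adj p w ↔ w = c) ∧
      ∀ w, G.Adj q w ↔ w = c := by
    rw [ncard_cutEdgesAt] at h3
    have pend : ∀ w, G.Adj c w ∧ G.IsBridge s(c, w) → ¬ G.Adj z w → ∀ u, G.Adj w u ↔ u = c := by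
      rintro w ⟨hw, hb⟩ hzw u
      refine ⟨fun hu => by_contra fun hne => ?_, fun hu => hu ▸ hw.symm⟩
      refine (h.not_isBridge_iff hw).2 (Or.inl ⟨u, (h.2 u).2 ⟨hne, ?_⟩, hu⟩) hb
      rintro rfl
      exact hzw hu.symm
    have excl : ∀ w w', G.Adj c w ∧ G.IsBridge s(c, w) → w' ≠ w → G.Adj z w → ¬ G.Adj z w' :=
      fun w w' hw hne hzw hzw' =>
        (h.not_isBridge_iff hw.1).2 (Or.inr ⟨hzw, w', hne, hzw'⟩) hw.2
    obtain ⟨a, b, d, ha, hb, hd, hab, had, hbd⟩ := (Set.two_lt_ncard_iff).1 h3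
    by_cases h1 : G.Adj z a
    · exact ⟨b, d, hbd, pend b hb (excl a b ha hab.symm h1), pend d hd (excl a d ha had.symm h1)⟩
    by_cases h2 : G.Adj z b
    · exact ⟨a, d, had, pend a ha h1, pend d hd (excl b d hb hbd.symm h2)⟩
    · exact ⟨a, b, hab, pend a ha h1, pend b hb h2⟩
  have hP : Gᶜ.IsUniqueNonNeighbor p c := isUniqueNonNeighbor_compl_iff.2 hp
  have hcp : c ≠ p := fun h' => (h' ▸ (hp c).2 rfl : G.Adj c c).ne rfl
  have hcq : c ≠ q := fun h' => (h' ▸ (hq c).2 rfl : G.Adj c c).ne rfl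
  have hzp : z ≠ p := fun h' => h.not_adj (h' ▸ ((hp c).2 rfl).symm)
  have hzq : z ≠ q := fun h' => h.not_adj (h' ▸ ((hq c).2 rfl).symm)
  have hQ : Gᶜ.IsUniqueNonNeighbor q c := isUniqueNonNeighbor_compl_iff.2 hq
  -- In the complement, each edge at `p` lies on a triangle with third vertex `q`, or `z` for the
  -- edge `pq`.
  have hempty : {w | Gᶜ.Adj p w ∧ Gᶜ.IsBridge s(p, w)} = ∅ := by
    refine Set.eq_empty_of_forall_notMem ?_
    rintro w ⟨hw, hb⟩
    refine (hP.not_isBridge_iff hw).2 (Or.inl ?_) hb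
    by_cases hwq : w = q
    · subst hwq
      exact ⟨z, (hP.2 z).2 ⟨hzp, h.1⟩, (hQ.2 z).2 ⟨hzq, h.1⟩⟩
    · exact ⟨q, (hP.2 q).2 ⟨hpq.symm, hcq.symm⟩,
        ((hQ.2 w).2 ⟨hwq, ((hP.2 w).1 hw).2⟩).symm⟩
  rw [hP.cfc_eq hc, ncard_cutEdgesAt, hempty]
  simp

/-- A connected graph on four vertices with connected complement is a tree. -/
lemma Connected.isTree_of_card_eq_four (hV : Fintype.card V = 4) (hG : G.Connected)
    (hc : Gᶜ.Connected) : G.IsTree := by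
  classical
  rw [isTree_iff_connected_and_card]
  refine ⟨hG, ?_⟩
  have h1 := hG.card_vert_le_card_edgeSet_add_one
  have h2 := hc.card_vert_le_card_edgeSet_add_one
  -- The six pairs split between two connected graphs, each needing at least three edges.
  have h3 : G.edgeSet.ncard + Gᶜ.edgeSet.ncard = 6 := by
    rw [← Set.ncard_union_eq (disjoint_edgeSet.2 disjoint_compl_right), ← edgeSet_sup,
      sup_compl_eq_top, ← coe_edgeFinset, Set.ncard_coe_finset,
      card_edgeFinset_top_eq_card_choose_two, hV]
    rfl
  rw [Nat.card_coe_set_eq, Nat.card_eq_fintype_card] at *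
  omega

end Nordhaus

end SimpleGraph

open SimpleGraph in
theorem mainTheorem8 {V : Type*} [Fintype V] [DecidableEq V]
    (G : SimpleGraph V) [DecidableRel G.Adj]
    (n : ℕ) (hn : Fintype.card V = n) (hn4 : 4 ≤ n)
    (hconn : G.Connected) (hG : G.edgeConn = 1) (hGc : Gᶜ.edgeConn = 1) :
    (4 ≤ G.cfc + Gᶜ.cfc ∧ G.cfc + Gᶜ.cfc ≤ n) ∧
    (4 ≤ G.cfc * Gᶜ.cfc ∧ G.cfc * Gᶜ.cfc ≤ 2 * (n - 2)) ∧
    (G.cfc + Gᶜ.cfc = n ↔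
      (G.IsTree ∧ G.maxDegree = n - 2) ∨ (Gᶜ.IsTree ∧ Gᶜ.maxDegree = n - 2)) ∧
    (G.cfc * Gᶜ.cfc = 2 * (n - 2) ↔
      (G.IsTree ∧ G.maxDegree = n - 2) ∨ (Gᶜ.IsTree ∧ Gᶜ.maxDegree = n - 2)) ∧
    (G.cfc + Gᶜ.cfc = 4 ↔
      G.AtMostTwoCutEdgesAtMaxDegree ∧ Gᶜ.AtMostTwoCutEdgesAtMaxDegree) ∧
    (G.cfc * Gᶜ.cfc = 4 ↔
      G.AtMostTwoCutEdgesAtMaxDegree ∧ Gᶜ.AtMostTwoCutEdgesAtMaxDegree) := by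
  subst hn
  obtain ⟨-, x, y, hxy, hb⟩ := connected_and_exists_isBridge_of_edgeConn_eq_one hG
  obtain ⟨hc, u, v, huv, hb'⟩ := connected_and_exists_isBridge_of_edgeConn_eq_one hGc
  obtain ⟨⟨c, z, h⟩, c', z', h'⟩ := exists_isUniqueNonNeighbor_of_bridges hxy hb huv hb'
  have hcc : Gᶜᶜ.Connected := by rwa [compl_compl]
  rw [h.atMostTwo_iff hconn hc, h'.atMostTwo_iff hc hcc, h.maxDegree_eq hc, h'.maxDegree_eq hcc,
    ← h.ncard_cutEdgesAt_eq_iff hconn, ← h'.ncard_cutEdgesAt_eq_iff hc]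
  have e1 := h.cfc_eq hconn
  have e2 := h'.cfc_eq hc
  have l1 := h.ncard_cutEdgesAt_le
  have l2 := h'.ncard_cutEdgesAt_le
  have t1 := h.cfc_compl_eq_two hc
  have t2 : 3 ≤ (Gᶜ.cutEdgesAt c').ncard → G.cfc = 2 := by
    simpa only [compl_compl] using h'.cfc_compl_eq_two hcc
  -- For `n = 4` the lower and upper bounds coincide, so the tree condition must hold automatically.
  have four : Fintype.card V = 4 → (G.cutEdgesAt c).ncard = Fintype.card V - 2 := fun hV =>
    (h.ncard_cutEdgesAt_eq_iff hconn).2 (hconn.isTree_of_card_eq_four hV hc)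
  -- Fixing one factor as 2 makes the product linear, within reach of `omega`.
  have htwo : G.cfc = 2 ∨ Gᶜ.cfc = 2 := by omega
  clear h h' hconn hc hcc hG hGc hb hb' hxy huv
  generalize G.cfc = p, Gᶜ.cfc = q, (G.cutEdgesAt c).ncard = r, (Gᶜ.cutEdgesAt c').ncard = s at *
  rcases htwo with rfl | rfl <;> refine ⟨⟨?_, ?_⟩, ⟨?_, ?_⟩, ?_, ?_, ?_, ?_⟩ <;> omega
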